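/- Let $\mathbf{T}=\mathbf{R}/\mathbf{Z}$ with its Haar measure, let $\alpha\in\mathbf{T}$ and let $A:\mathbf{T}\to SL(2,\mathbf{R})$ be continuous. For $n\ge 1$ and $\theta\in\mathbf{T}$ put $$A_n(\theta)=A(\theta+(n-1)\alpha)\cdots A(\theta),\qquad A_{-n}(\theta)=A(\theta-n\alpha)^{-1}\cdots A(\theta-\alpha)^{-1},\qquad A_0(\theta)=I .$$ Suppose that the cocycle $(\alpha,A)$ has bounded fibered products, that is, $$\sup_{k\in\mathbf{Z}}\ \sup_{\theta\in\mathbf{T}}\|A_k(\theta)\|<\infty .$$ Then there is a measurable map $B:\mathbf{T}\to SL(2,\mathbf{R})$ with $\operatorname{ess\,sup}_{\theta\in\mathbf{T}}\|B(\theta)\|<\infty$ such that, for almost every $\theta\in\mathbf{T}$, the matrix $$B(\theta+\alpha)^{-1}A(\theta)B(\theta)$$ is a rotation matrix, i.e. an element of $SO(2,\mathbf{R})$. -/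

import Mathlib

open MeasureTheory
open scoped MatrixGroups

/-- Forward fibered products over the rotation by `α`:
`A_n(θ) = A(θ + (n-1)α) ⋯ A(θ)` for `n ≥ 1`, and `A_0 = 1`. -/
def fiberedProductPos (α : UnitAddCircle) (A : UnitAddCircle → SL(2, ℝ)) :
    ℕ → UnitAddCircle → SL(2, ℝ)
  | 0, _ => 1
  | n + 1, θ => A (θ + n • α) * fiberedProductPos α A n θ

/-- Backward fibered products over the rotation by `α`:
`A_{-n}(θ) = A(θ - nα)⁻¹ ⋯ A(θ - α)⁻¹` for `n ≥ 1`, and `A_0 = 1`. -/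
def fiberedProductNeg (α : UnitAddCircle) (A : UnitAddCircle → SL(2, ℝ)) :
    ℕ → UnitAddCircle → SL(2, ℝ)
  | 0, _ => 1
  | n + 1, θ => (A (θ - (n + 1) • α))⁻¹ * fiberedProductNeg α A n θ

/-- The fibered products `A_k`, `k ∈ ℤ`, of the cocycle `(α, A)`; they satisfy
`(α, A)^k (θ, y) = (θ + kα, A_k(θ) y)`. -/
def fiberedProduct (α : UnitAddCircle) (A : UnitAddCircle → SL(2, ℝ)) :
    ℤ → UnitAddCircle → SL(2, ℝ)
  | Int.ofNat n => fiberedProductPos α A n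
  | Int.negSucc n => fiberedProductNeg α A (n + 1)

open scoped Matrix.Norms.Elementwise in
/-- `sup_{k ∈ ℤ} sup_{θ ∈ 𝕋} ‖A_k(θ)‖ < ∞`, with the maximum of the absolute values of the
entries as norm (all norms on real `2 × 2` matrices are equivalent). -/
def HasBoundedFiberedProducts (α : UnitAddCircle) (A : UnitAddCircle → SL(2, ℝ)) : Prop :=
  ∃ C : ℝ, ∀ (k : ℤ) (θ : UnitAddCircle),
    ‖(fiberedProduct α A k θ : Matrix (Fin 2) (Fin 2) ℝ)‖ ≤ C

open scoped Matrix.Norms.Elementwise in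
/-- `B : 𝕋 → SL(2, ℝ)` is essentially bounded for the Haar measure of `𝕋`, as a matrix-valued
map. -/
def IsLinftyBounded (B : UnitAddCircle → SL(2, ℝ)) : Prop :=
  MemLp (fun θ => (B θ : Matrix (Fin 2) (Fin 2) ℝ)) ⊤ (volume : Measure UnitAddCircle)

/-- Measurability of `B : 𝕋 → SL(2, ℝ)`, for the Borel structure that `SL(2, ℝ)` inherits from
the space of matrices. -/
def IsMeasurableSL (B : UnitAddCircle → SL(2, ℝ)) : Prop :=
  ∀ i j : Fin 2, Measurable (fun θ => (B θ : Matrix (Fin 2) (Fin 2) ℝ) i j)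

/-- Rotation matrices, that is, the elements of `SO(2, ℝ)`. -/
def IsRotationMatrix (M : SL(2, ℝ)) : Prop :=
  ∃ φ : ℝ, (M : Matrix (Fin 2) (Fin 2) ℝ) =
    !![Real.cos φ, -Real.sin φ; Real.sin φ, Real.cos φ]

open Matrix
open scoped MatrixOrder

/-! For a cocycle `P` of unimodular matrices over a group action, let `E(x)` be the set of vectors
that every `P g x` maps into the unit ball. The cocycle identity says that `P h x` maps `E(x)` onto
`E(h • x)`, and if `P` is bounded then `E(x)` lies between two fixed balls. Since `P h x` preserves
Lebesgue measure, the second moment matrices `M(x) = ∫ v vᵀ dv` over `E(x)` satisfy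
`M(h • x) = P h x * M(x) * (P h x)ᵀ`. The two balls confine `M(x)` to a compact set of positive
definite matrices, on which the square root `B(x)` of `M(x)`, rescaled to determinant one, is
bounded; and `B(x) * B(x)ᵀ` transforms like `M(x)`, so `B(h • x)⁻¹ * P h x * B(x)` is orthogonal. -/

theorem measurable_comp_of_continuousOn {X Y Z : Type*} [MeasurableSpace X] [TopologicalSpace Y]
    [MeasurableSpace Y] [OpensMeasurableSpace Y] [TopologicalSpace Z] [MeasurableSpace Z]
    [BorelSpace Z] {F : Y → Z} {K : Set Y} (hF : ContinuousOn F K) {f : X → Y} (hf : Measurable f)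
    (hfK : ∀ x, f x ∈ K) : Measurable fun x => F (f x) :=
  hF.domRestrict.measurable.comp (hf.subtype_mk (h := hfK))

theorem isClosed_setOf_posSemidef {n : Type*} : IsClosed {S : Matrix n n ℝ | S.PosSemidef} := by
  simp only [PosSemidef, IsHermitian, Finsupp.sum, Set.ofPred_and, Set.ofPred_forall]
  exact (isClosed_eq (by fun_prop) continuous_id).inter
    (isClosed_iInter fun v => isClosed_le continuous_const (by fun_prop))

theorem isCompact_setOf_le_and_abs_le {n : Type*} (S₀ : Matrix n n ℝ) (C : n → n → ℝ) :
    IsCompact {S | S₀ ≤ S ∧ ∀ i j, |S i j| ≤ C i j} := by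
  have hbox : IsCompact {S : Matrix n n ℝ | ∀ i j, |S i j| ≤ C i j} := by
    simpa only [Set.pi, Set.mem_univ, true_imp_iff, Set.mem_Icc, ← abs_le] using!
      isCompact_univ_pi fun i => isCompact_univ_pi fun j => isCompact_Icc (a := -C i j) (b := C i j)
  exact hbox.inter_left (isClosed_setOf_posSemidef.preimage (continuous_id.sub continuous_const))

theorem inv_mul_mul_mem_orthogonalGroup {n R : Type*} [Fintype n] [DecidableEq n] [CommRing R]
    {A B B' : Matrix.SpecialLinearGroup n R} (h : A.1 * (B.1 * B.1ᵀ) * A.1ᵀ = B'.1 * B'.1ᵀ) :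
    (B'⁻¹ * A * B).1 ∈ orthogonalGroup n R := by
  have hinv : (B'⁻¹).1 * B'.1 = 1 := congrArg Subtype.val (inv_mul_cancel B')
  rw [mem_orthogonalGroup_iff]
  calc (B'⁻¹ * A * B).1 * (B'⁻¹ * A * B).1ᵀ
      = (B'⁻¹).1 * (A.1 * (B.1 * B.1ᵀ) * A.1ᵀ) * (B'⁻¹).1ᵀ := by
        have hmul : (B'⁻¹ * A * B).1 = (B'⁻¹).1 * A.1 * B.1 := rfl
        simp only [hmul, transpose_mul, Matrix.mul_assoc]
    _ = (B'⁻¹).1 * B'.1 * ((B'⁻¹).1 * B'.1)ᵀ := by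
        simp only [h, transpose_mul, Matrix.mul_assoc]
    _ = 1 := by rw [hinv, transpose_one, mul_one]

section UnimodularSqrt

variable {n : Type*} [Fintype n] [DecidableEq n]

/-- The positive square root of the positive multiple of `S` of determinant one. It is meant for
positive definite `S` only; elsewhere the real power and the square root take junk values. -/
noncomputable def unimodularSqrt (S : Matrix n n ℝ) : Matrix n n ℝ :=
  CFC.sqrt ((S.det ^ (-(Fintype.card n : ℝ)⁻¹)) • S)

theorem posDef_det_rpow_smul {S : Matrix n n ℝ} (hS : S.PosDef) (r : ℝ) :
    (S.det ^ r • S).PosDef :=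
  hS.smul (Real.rpow_pos_of_pos hS.det_pos _)

theorem det_unimodularSqrt {S : Matrix n n ℝ} (hS : S.PosDef) :
    (unimodularSqrt S).det = 1 := by
  cases isEmpty_or_nonempty n
  · exact det_isEmpty
  · have hone : (S.det ^ (-(Fintype.card n : ℝ)⁻¹)) ^ Fintype.card n * S.det = 1 := by
      rw [← Real.rpow_mul_natCast hS.det_pos.le, neg_mul, inv_mul_cancel₀ (by simp),
        Real.rpow_neg_one, inv_mul_cancel₀ hS.det_pos.ne']
    rw [unimodularSqrt, (posDef_det_rpow_smul hS _).posSemidef.det_sqrt, det_smul, hone]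
    simp

theorem unimodularSqrt_mul_transpose {S : Matrix n n ℝ} (hS : S.PosDef) :
    unimodularSqrt S * (unimodularSqrt S)ᵀ = S.det ^ (-(Fintype.card n : ℝ)⁻¹) • S := by
  have hsymm : (unimodularSqrt S)ᵀ = unimodularSqrt S :=
    (CFC.sqrt_nonneg _).posSemidef.isHermitian
  rw [hsymm]
  exact CFC.sqrt_mul_sqrt_self _ (posDef_det_rpow_smul hS _).posSemidef.nonneg

open scoped Matrix.Norms.L2Operator in
theorem continuousOn_unimodularSqrt :
    ContinuousOn unimodularSqrt {S : Matrix n n ℝ | S.PosDef} := by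
  have hsqrt : ContinuousOn CFC.sqrt {S : Matrix n n ℝ | S.PosSemidef} := by
    simpa only [nonneg_iff_posSemidef] using CFC.continuousOn_sqrt (A := Matrix n n ℝ)
  have hdet : ContinuousOn (fun S : Matrix n n ℝ => S.det ^ (-(Fintype.card n : ℝ)⁻¹))
      {S | S.PosDef} :=
    continuous_id.matrix_det.continuousOn.rpow_const fun S hS => .inl (PosDef.det_pos hS).ne'
  exact hsqrt.comp (hdet.smul continuousOn_id)
    fun S hS => (posDef_det_rpow_smul hS _).posSemidef

open scoped Matrix.Norms.Elementwise in
theorem exists_abs_unimodularSqrt_le {K : Set (Matrix n n ℝ)} (hK : IsCompact K)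
    (hpos : K ⊆ {S | S.PosDef}) : ∃ C, ∀ S ∈ K, ∀ i j, |unimodularSqrt S i j| ≤ C := by
  obtain ⟨C, hC⟩ := hK.exists_bound_of_continuousOn (continuousOn_unimodularSqrt.mono hpos)
  exact ⟨C, fun S hS i j => (Matrix.norm_entry_le_entrywise_sup_norm _).trans (hC S hS)⟩

theorem measurable_unimodularSqrt {X : Type*} [MeasurableSpace X] {M : X → Matrix n n ℝ}
    (hM : ∀ i j, Measurable fun x => M x i j) (hpos : ∀ x, (M x).PosDef) (i j : n) :
    Measurable fun x => unimodularSqrt (M x) i j := by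
  have hcont : ContinuousOn (fun S : n → n → ℝ => unimodularSqrt (.of S) i j)
      {S | (Matrix.of S).PosDef} :=
    (continuous_apply_apply i j).comp_continuousOn continuousOn_unimodularSqrt
  exact measurable_comp_of_continuousOn (f := M) hcont
    (measurable_pi_lambda _ fun i => measurable_pi_lambda _ (hM i)) hpos

theorem unimodularSqrt_conj_mul_transpose {S T : Matrix n n ℝ} (hS : S.PosDef) (hT : T.PosDef)
    {A : Matrix.SpecialLinearGroup n ℝ} (hST : T = A.1 * S * A.1ᵀ) :
    A.1 * (unimodularSqrt S * (unimodularSqrt S)ᵀ) * A.1ᵀ =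
      unimodularSqrt T * (unimodularSqrt T)ᵀ := by
  have hdet : T.det = S.det := by simp [hST]
  rw [unimodularSqrt_mul_transpose hS, unimodularSqrt_mul_transpose hT, hdet, hST,
    Matrix.mul_smul, Matrix.smul_mul]

end UnimodularSqrt

section SecondMoment

variable {m n : Type*} [Fintype n] {μ ν : Measure (n → ℝ)}

/-- The matrix `∫ v vᵀ dμ(v)` of uncentered second moments of a measure on `ℝⁿ`. -/
noncomputable def secondMoment {n : Type*} (μ : Measure (n → ℝ)) : Matrix n n ℝ :=
  Matrix.of fun i j => ∫ v, v i * v j ∂μ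

theorem isHermitian_secondMoment {n : Type*} (μ : Measure (n → ℝ)) :
    (secondMoment μ).IsHermitian := by
  ext i j
  simp only [secondMoment, conjTranspose_apply, of_apply, star_trivial, mul_comm]

theorem memLp_dotProduct {p : ENNReal} (hμ : MemLp id p μ) (u : n → ℝ) :
    MemLp (fun v => u ⬝ᵥ v) p μ :=
  memLp_finsetSum _ fun i _ => (hμ.eval i).const_mul (u i)

theorem dotProduct_secondMoment_mulVec (hμ : MemLp id 2 μ) (u w : n → ℝ) :
    u ⬝ᵥ secondMoment μ *ᵥ w = ∫ v, (u ⬝ᵥ v) * (w ⬝ᵥ v) ∂μ := by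
  have hint (i j : n) : Integrable (fun v => u i * v i * (w j * v j)) μ :=
    ((hμ.eval i).const_mul (u i)).integrable_mul ((hμ.eval j).const_mul (w j))
  simp only [dotProduct, mulVec, secondMoment, of_apply, Finset.sum_mul_sum]
  rw [integral_finsetSum _ fun i _ => integrable_finsetSum _ fun j _ => hint i j]
  refine Finset.sum_congr rfl fun i _ => ?_
  rw [integral_finsetSum _ fun j _ => hint i j, Finset.mul_sum]
  refine Finset.sum_congr rfl fun j _ => ?_
  rw [← integral_mul_const, ← integral_const_mul]
  congr with v
  ring

theorem measurable_mulVec (A : Matrix m n ℝ) : Measurable (A *ᵥ ·) :=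
  measurable_pi_lambda _ fun i => (by fun_prop : Continuous fun v => A.row i ⬝ᵥ v).measurable

theorem secondMoment_map_mulVec (hμ : MemLp id 2 μ) (A : Matrix m n ℝ) :
    secondMoment (μ.map (A *ᵥ ·)) = A * secondMoment μ * Aᵀ := by
  ext i j
  calc secondMoment (μ.map (A *ᵥ ·)) i j
      = ∫ v, (A *ᵥ v) i * (A *ᵥ v) j ∂μ :=
        integral_map (measurable_mulVec A).aemeasurable (by fun_prop)
    _ = A.row i ⬝ᵥ secondMoment μ *ᵥ A.row j :=
        (dotProduct_secondMoment_mulVec hμ (A.row i) (A.row j)).symm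
    _ = (A * secondMoment μ * Aᵀ) i j := by
        rw [Matrix.mul_assoc]
        rfl

theorem secondMoment_mono (hμν : μ ≤ ν) (hν : MemLp id 2 ν) :
    secondMoment μ ≤ secondMoment ν := by
  refine .of_dotProduct_mulVec_nonneg
    ((isHermitian_secondMoment ν).sub (isHermitian_secondMoment μ)) fun u => ?_
  rw [star_trivial, sub_mulVec, dotProduct_sub, sub_nonneg,
    dotProduct_secondMoment_mulVec (hν.mono_measure hμν), dotProduct_secondMoment_mulVec hν]
  exact integral_mono_measure hμν (.of_forall fun _ => mul_self_nonneg _)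
    ((memLp_dotProduct hν u).integrable_mul (memLp_dotProduct hν u))

theorem abs_secondMoment_le (hμν : μ ≤ ν) (hν : MemLp id 2 ν) (i j : n) :
    |secondMoment μ i j| ≤ ∫ v, |v i * v j| ∂ν :=
  abs_integral_le_integral_abs.trans <| integral_mono_measure hμν
    (.of_forall fun _ => abs_nonneg _) ((hν.eval i).integrable_mul (hν.eval j)).abs

theorem memLp_id_restrict {E : Set (n → ℝ)} (hE : Bornology.IsBounded E) (p : ENNReal) :
    MemLp id p (volume.restrict E) := by
  obtain ⟨r, hr⟩ := hE.subset_closedBall 0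
  have : IsFiniteMeasure (volume.restrict (Metric.closedBall (0 : n → ℝ) r)) :=
    isFiniteMeasure_restrict.2 Metric.isBounded_closedBall.measure_lt_top.ne
  refine MemLp.mono_measure (Measure.restrict_mono_set _ hr) ?_
  refine .of_bound aestronglyMeasurable_id r ?_
  exact ae_restrict_of_forall_mem measurableSet_closedBall fun v hv => mem_closedBall_zero_iff.1 hv

theorem posDef_secondMoment_restrict {U : Set (n → ℝ)} (hU : U ∈ nhds 0)
    (hU' : Bornology.IsBounded U) : (secondMoment (volume.restrict U)).PosDef := by
  refine .of_dotProduct_mulVec_pos (isHermitian_secondMoment _) fun u hu => ?_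
  have hL2 := memLp_id_restrict hU' 2
  have hnonneg : 0 ≤ fun v : n → ℝ => (u ⬝ᵥ v) * (u ⬝ᵥ v) := fun v => mul_self_nonneg _
  have hcont : Continuous fun v : n → ℝ => (u ⬝ᵥ v) * (u ⬝ᵥ v) := by fun_prop
  rw [star_trivial, dotProduct_secondMoment_mulVec hL2]
  refine (integral_nonneg hnonneg).lt_of_ne' fun hzero => hu ?_
  rw [integral_eq_zero_iff_of_nonneg hnonneg
    ((memLp_dotProduct hL2 u).integrable_mul (memLp_dotProduct hL2 u))] at hzero
  have hvanish : Set.EqOn (fun v => (u ⬝ᵥ v) * (u ⬝ᵥ v)) 0 (interior U) :=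
    Measure.eqOn_open_of_ae_eq (ae_restrict_of_ae_restrict_of_subset interior_subset hzero)
      isOpen_interior hcont.continuousOn continuousOn_const
  have hsmall : ∀ᶠ t : ℝ in nhds 0, t • u ∈ interior U := by
    refine (by fun_prop : Continuous fun t : ℝ => t • u).continuousAt.eventually_mem ?_
    simpa using interior_mem_nhds.2 hU
  obtain ⟨t, ht, ht0⟩ := ((hsmall.filter_mono nhdsWithin_le_nhds).and
    (self_mem_nhdsWithin : {0}ᶜ ∈ nhdsWithin (0 : ℝ) {0}ᶜ)).exists
  simpa [show t ≠ 0 from ht0] using hvanish ht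

theorem measurable_secondMoment_restrict {X : Type*} [MeasurableSpace X] {E : X → Set (n → ℝ)}
    (hE : MeasurableSet {p : X × (n → ℝ) | p.2 ∈ E p.1}) (i j : n) :
    Measurable fun x => secondMoment (volume.restrict (E x)) i j := by
  have hEx (x : X) : MeasurableSet (E x) := measurable_prodMk_left hE
  simp only [secondMoment, of_apply, ← integral_indicator (hEx _)]
  have hind : Measurable ({p : X × (n → ℝ) | p.2 ∈ E p.1}.indicator fun p => p.2 i * p.2 j) :=
    Measurable.indicator (by fun_prop) hE
  exact hind.stronglyMeasurable.integral_prod_right'.measurable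

theorem exists_isCompact_secondMoment_restrict_mem {U V : Set (n → ℝ)}
    (hU : U ∈ nhds 0) (hU' : Bornology.IsBounded U) (hV : Bornology.IsBounded V) :
    ∃ K ⊆ {S : Matrix n n ℝ | S.PosDef}, IsCompact K ∧
      ∀ E, U ⊆ E → E ⊆ V → secondMoment (volume.restrict E) ∈ K := by
  refine ⟨_, fun S hS => ?_, isCompact_setOf_le_and_abs_le (secondMoment (volume.restrict U))
    fun i j => ∫ v in V, |v i * v j|, fun E hUE hEV => ⟨?_, ?_⟩⟩
  · simpa using (posDef_secondMoment_restrict hU hU').add_posSemidef hS.1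
  · exact secondMoment_mono (Measure.restrict_mono_set _ hUE) (memLp_id_restrict (hV.subset hEV) 2)
  · exact abs_secondMoment_le (Measure.restrict_mono_set _ hEV) (memLp_id_restrict hV 2)

theorem measurePreserving_mulVec [DecidableEq n] {A : Matrix n n ℝ} (hA : |A.det| = 1) :
    MeasurePreserving (A *ᵥ ·) (volume : Measure (n → ℝ)) volume := by
  refine ⟨measurable_mulVec A, ?_⟩
  have h := Real.map_matrix_volume_pi_eq_smul_volume_pi (M := A) fun h0 => by
    simp [h0] at hA
  rwa [abs_inv, hA, inv_one, ENNReal.ofReal_one, one_smul] at h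

theorem secondMoment_restrict_eq_mul_mul_transpose [DecidableEq n] {A : Matrix n n ℝ}
    (hA : |A.det| = 1) {E : Set (n → ℝ)} (hE : MeasurableSet E)
    (hbdd : Bornology.IsBounded ((A *ᵥ ·) ⁻¹' E)) :
    secondMoment (volume.restrict E) =
      A * secondMoment (volume.restrict ((A *ᵥ ·) ⁻¹' E)) * Aᵀ := by
  rw [← secondMoment_map_mulVec (memLp_id_restrict hbdd 2),
    ((measurePreserving_mulVec hA).restrict_preimage hE).map_eq]

end SecondMoment

section Cocycle

variable {n G X : Type*} [Fintype n]

/-- The set of vectors that stay in the unit ball under all matrices `P g x`, `g : G`, of a cocycle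
`P` over an action of `G` on `X`. The norm is the sup norm of `n → ℝ`. -/
def unitOrbitSet (P : G → X → Matrix n n ℝ) (x : X) : Set (n → ℝ) :=
  {v | ∀ g, ‖P g x *ᵥ v‖ ≤ 1}

theorem preimage_mulVec_unitOrbitSet [Group G] [SMul G X] {P : G → X → Matrix n n ℝ}
    {h : G} {x : X} (hP : ∀ g, P (g * h) x = P g (h • x) * P h x) :
    (P h x *ᵥ ·) ⁻¹' unitOrbitSet P (h • x) = unitOrbitSet P x := by
  ext v
  simp only [unitOrbitSet, Set.mem_preimage, Set.mem_ofPred_eq, mulVec_mulVec, ← hP]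
  exact (Equiv.mulRight h).forall_congr fun _ => Iff.rfl

theorem unitOrbitSet_subset_closedBall [DecidableEq n] {P : G → X → Matrix n n ℝ} {g : G} {x : X}
    (hP : P g x = 1) : unitOrbitSet P x ⊆ Metric.closedBall 0 1 := fun v hv => by
  simpa [hP] using hv g

theorem norm_mulVec_le_card_mul {A : Matrix n n ℝ} {C : ℝ} (hC : 0 ≤ C)
    (hA : ∀ i j, |A i j| ≤ C) (v : n → ℝ) : ‖A *ᵥ v‖ ≤ Fintype.card n * C * ‖v‖ := by
  refine (pi_norm_le_iff_of_nonneg (by positivity)).2 fun i => ?_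
  calc ‖(A *ᵥ v) i‖ ≤ ∑ j, ‖A i j * v j‖ := norm_sum_le _ _
    _ ≤ ∑ _j : n, C * ‖v‖ := Finset.sum_le_sum fun j _ => by
        rw [norm_mul]
        exact mul_le_mul (hA i j) (norm_le_pi_norm v j) (norm_nonneg _) hC
    _ = Fintype.card n * C * ‖v‖ := by simp [mul_assoc]

theorem closedBall_subset_unitOrbitSet {P : G → X → Matrix n n ℝ} {x : X} {C : ℝ} (hC : 0 ≤ C)
    (hP : ∀ g i j, |P g x i j| ≤ C) :
    Metric.closedBall 0 (Fintype.card n * C + 1)⁻¹ ⊆ unitOrbitSet P x := fun v hv g => by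
  have hpos : 0 < Fintype.card n * C + 1 := by positivity
  calc ‖P g x *ᵥ v‖ ≤ Fintype.card n * C * ‖v‖ := norm_mulVec_le_card_mul hC (hP g) v
    _ ≤ (Fintype.card n * C + 1) * (Fintype.card n * C + 1)⁻¹ :=
        mul_le_mul (by linarith) (mem_closedBall_zero_iff.1 hv) (norm_nonneg v) hpos.le
    _ = 1 := mul_inv_cancel₀ hpos.ne'

theorem measurableSet_setOf_mem_unitOrbitSet [Countable G] [MeasurableSpace X]
    {P : G → X → Matrix n n ℝ} (hP : ∀ g i j, Measurable fun x => P g x i j) :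
    MeasurableSet {p : X × (n → ℝ) | p.2 ∈ unitOrbitSet P p.1} := by
  have hmul (g : G) : Measurable fun p : X × (n → ℝ) => P g p.1 *ᵥ p.2 :=
    measurable_pi_lambda _ fun i => Finset.measurable_fun_sum _ fun j _ =>
      ((hP g i j).comp measurable_fst).mul (by fun_prop)
  have hset : {p : X × (n → ℝ) | p.2 ∈ unitOrbitSet P p.1} = ⋂ g, {p | ‖P g p.1 *ᵥ p.2‖ ≤ 1} := by
    ext p
    simp [unitOrbitSet]
  rw [hset]
  exact .iInter fun g => measurableSet_le (hmul g).norm measurable_const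

theorem secondMoment_restrict_unitOrbitSet_smul [DecidableEq n] [Group G] [SMul G X]
    {P : G → X → Matrix n n ℝ} {h : G} {x : X}
    (hP : ∀ g, P (g * h) x = P g (h • x) * P h x) (hdet : |(P h x).det| = 1)
    (hE : MeasurableSet (unitOrbitSet P (h • x))) (hbdd : Bornology.IsBounded (unitOrbitSet P x)) :
    secondMoment (volume.restrict (unitOrbitSet P (h • x))) =
      P h x * secondMoment (volume.restrict (unitOrbitSet P x)) * (P h x)ᵀ := by
  rw [← preimage_mulVec_unitOrbitSet hP] at hbdd
  rw [secondMoment_restrict_eq_mul_mul_transpose hdet hE hbdd, preimage_mulVec_unitOrbitSet hP]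

end Cocycle

theorem mainTheorem11_general {n G X : Type*} [Fintype n] [DecidableEq n] [Group G] [Countable G]
    [MulAction G X] [MeasurableSpace X] (P : G → X → Matrix.SpecialLinearGroup n ℝ)
    (hP : ∀ g h x, P (g * h) x = P g (h • x) * P h x)
    (hmeas : ∀ g i j, Measurable fun x => (P g x).1 i j)
    (hbdd : ∃ C, ∀ g x i j, |(P g x).1 i j| ≤ C) :
    ∃ B : X → Matrix.SpecialLinearGroup n ℝ, (∀ i j, Measurable fun x => (B x).1 i j) ∧
      (∃ C, ∀ x i j, |(B x).1 i j| ≤ C) ∧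
      ∀ g x, ((B (g • x))⁻¹ * P g x * B x).1 ∈ specialOrthogonalGroup n ℝ := by
  obtain ⟨C, hC⟩ := hbdd
  set E := unitOrbitSet fun g x => (P g x).1
  set M := fun x => secondMoment (volume.restrict (E x))
  have hone (x : X) : P 1 x = 1 := by simpa only [one_smul, mul_one, left_eq_mul] using hP 1 1 x
  have hball (x : X) : Metric.closedBall 0 (Fintype.card n * |C| + 1)⁻¹ ⊆ E x :=
    closedBall_subset_unitOrbitSet (abs_nonneg C) fun g i j => (hC g x i j).trans (le_abs_self C)
  have hunit (x : X) : E x ⊆ Metric.closedBall 0 1 :=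
    unitOrbitSet_subset_closedBall (g := 1) (congrArg Subtype.val (hone x))
  have hE := measurableSet_setOf_mem_unitOrbitSet hmeas
  obtain ⟨K, hKpos, hK, hKE⟩ := exists_isCompact_secondMoment_restrict_mem
    (Metric.closedBall_mem_nhds (0 : n → ℝ) (ε := (Fintype.card n * |C| + 1)⁻¹) (by positivity))
    Metric.isBounded_closedBall (Metric.isBounded_closedBall (x := 0) (r := 1))
  have hMK (x : X) : M x ∈ K := hKE (E x) (hball x) (hunit x)
  have hpos (x : X) : (M x).PosDef := hKpos (hMK x)
  obtain ⟨D, hD⟩ := exists_abs_unimodularSqrt_le hK hKpos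
  refine ⟨fun x => ⟨unimodularSqrt (M x), det_unimodularSqrt (hpos x)⟩,
    measurable_unimodularSqrt (measurable_secondMoment_restrict hE) hpos,
    ⟨D, fun x => hD (M x) (hMK x)⟩, fun g x => mem_specialOrthogonalGroup_iff.2 ⟨?_, ?_⟩⟩
  · refine inv_mul_mul_mem_orthogonalGroup (unimodularSqrt_conj_mul_transpose (hpos x) (hpos _) ?_)
    exact secondMoment_restrict_unitOrbitSet_smul (fun k => congrArg Subtype.val (hP k g x))
      (by simp) (measurable_prodMk_left hE) (Metric.isBounded_closedBall.subset (hunit x))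
  · exact Matrix.SpecialLinearGroup.det_coe _

section Circle

/-- The action of `ℤ` on the circle in which `k` is the rotation by `k • α`, in multiplicative
notation, as `fiberedProduct` is a cocycle over it. -/
abbrev rotationAction (α : UnitAddCircle) : MulAction (Multiplicative ℤ) UnitAddCircle :=
  MulAction.compHom (M := Multiplicative UnitAddCircle) UnitAddCircle
    (zmultiplesHom UnitAddCircle α).toMultiplicative

variable (α : UnitAddCircle) (A : UnitAddCircle → SL(2, ℝ))

theorem fiberedProductPos_add_mul (n : ℕ) (θ : UnitAddCircle) :
    fiberedProductPos α A n (θ + α) * A θ = fiberedProductPos α A (n + 1) θ := by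
  induction n with
  | zero => simp [fiberedProductPos]
  | succ n ih =>
    change A (θ + α + n • α) * fiberedProductPos α A n (θ + α) * A θ =
      A (θ + (n + 1) • α) * fiberedProductPos α A (n + 1) θ
    rw [mul_assoc, ih, add_assoc, ← succ_nsmul']

theorem fiberedProductNeg_add_mul (n : ℕ) (θ : UnitAddCircle) :
    fiberedProductNeg α A (n + 1) (θ + α) * A θ = fiberedProductNeg α A n θ := by
  induction n with
  | zero => simp [fiberedProductNeg]
  | succ n ih =>
    rw [fiberedProductNeg, mul_assoc, ih, fiberedProductNeg, succ_nsmul _ (n + 1),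
      add_sub_add_right_eq_sub]

theorem fiberedProduct_add_one (k : ℤ) (θ : UnitAddCircle) :
    fiberedProduct α A (k + 1) θ = fiberedProduct α A k (θ + α) * A θ := by
  match k with
  | Int.ofNat n => exact (fiberedProductPos_add_mul α A n θ).symm
  | Int.negSucc 0 => exact (fiberedProductNeg_add_mul α A 0 θ).symm
  | Int.negSucc (n + 1) => exact (fiberedProductNeg_add_mul α A (n + 1) θ).symm

theorem fiberedProduct_zero (θ : UnitAddCircle) : fiberedProduct α A 0 θ = 1 :=
  rfl

theorem fiberedProduct_one (θ : UnitAddCircle) : fiberedProduct α A 1 θ = A θ := by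
  simpa [fiberedProduct_zero] using fiberedProduct_add_one α A 0 θ

theorem fiberedProduct_sub_one (k : ℤ) (θ : UnitAddCircle) :
    fiberedProduct α A (k - 1) θ = fiberedProduct α A k (θ - α) * (A (θ - α))⁻¹ := by
  rw [← sub_add_cancel k 1, fiberedProduct_add_one, add_sub_cancel_right, sub_add_cancel,
    mul_inv_cancel_right]

theorem fiberedProduct_add (j k : ℤ) (θ : UnitAddCircle) :
    fiberedProduct α A (j + k) θ = fiberedProduct α A j (k • α + θ) * fiberedProduct α A k θ := by
  induction k generalizing θ with
  | zero => simp [fiberedProduct_zero]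
  | succ k ih =>
    rw [← add_assoc, fiberedProduct_add_one, ih, fiberedProduct_add_one, mul_assoc, add_zsmul,
      one_zsmul, add_right_comm, add_assoc]
  | pred k ih =>
    rw [← add_sub_assoc, fiberedProduct_sub_one, ih, fiberedProduct_sub_one, mul_assoc,
      sub_one_zsmul, add_assoc, neg_add_eq_sub]

variable {A}

theorem continuous_fiberedProductPos (hA : Continuous A) (n : ℕ) :
    Continuous (fiberedProductPos α A n) := by
  induction n with
  | zero => exact continuous_const
  | succ n ih => exact (hA.comp (continuous_add_const _)).mul ih

theorem continuous_fiberedProductNeg (hA : Continuous A) (n : ℕ) :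
    Continuous (fiberedProductNeg α A n) := by
  induction n with
  | zero => exact continuous_const
  | succ n ih => exact (hA.comp (continuous_sub_right _)).inv.mul ih

theorem continuous_fiberedProduct (hA : Continuous A) (k : ℤ) :
    Continuous (fiberedProduct α A k) :=
  match k with
  | Int.ofNat n => continuous_fiberedProductPos α hA n
  | Int.negSucc n => continuous_fiberedProductNeg α hA (n + 1)

theorem isMeasurableSL_of_continuous {B : UnitAddCircle → SL(2, ℝ)} (hB : Continuous B) :
    IsMeasurableSL B :=
  fun i j => ((continuous_subtype_val.comp hB).matrix_elem i j).measurable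

open scoped Matrix.Norms.Elementwise in
theorem HasBoundedFiberedProducts.exists_abs_le {α : UnitAddCircle}
    {A : UnitAddCircle → SL(2, ℝ)} (h : HasBoundedFiberedProducts α A) :
    ∃ C, ∀ k θ i j, |(fiberedProduct α A k θ).1 i j| ≤ C :=
  h.imp fun _ hC k θ _ _ => (norm_entry_le_entrywise_sup_norm _).trans (hC k θ)

open scoped Matrix.Norms.Elementwise in
theorem isLinftyBounded_of_abs_le {B : UnitAddCircle → SL(2, ℝ)} (hB : IsMeasurableSL B) {C : ℝ}
    (hC : ∀ θ i j, |(B θ).1 i j| ≤ C) : IsLinftyBounded B := by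
  refine memLp_top_of_bound ?_ C (.of_forall fun θ => ?_)
  · exact (measurable_pi_lambda _ fun i => measurable_pi_lambda _ (hB i)).aestronglyMeasurable
  · exact (norm_le_iff ((abs_nonneg _).trans (hC θ 0 0))).2 (hC θ)

theorem isRotationMatrix_of_mem_specialOrthogonalGroup {R : SL(2, ℝ)}
    (hR : R.1 ∈ specialOrthogonalGroup (Fin 2) ℝ) : IsRotationMatrix R := by
  obtain ⟨hdiag, hoff, hsq⟩ := mem_specialOrthogonalGroup_fin_two_iff.1 hR
  set z : ℂ := ⟨R.1 0 0, R.1 1 0⟩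
  have hnorm : ‖z‖ = 1 := by
    rw [Complex.norm_def, Complex.normSq_mk, ← sq, ← sq, ← neg_sq (R.1 1 0), ← hoff, hsq,
      Real.sqrt_one]
  have hz0 : z ≠ 0 := norm_ne_zero_iff.1 (hnorm.trans_ne one_ne_zero)
  refine ⟨z.arg, ?_⟩
  rw [Complex.cos_arg hz0, Complex.sin_arg, hnorm, div_one, div_one]
  ext i j
  fin_cases i <;> fin_cases j
  exacts [rfl, hoff, rfl, hdiag.symm]

end Circle

theorem mainTheorem11 (α : UnitAddCircle) (A : UnitAddCircle → SL(2, ℝ)) (hA : Continuous A)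
    (hbdd : HasBoundedFiberedProducts α A) :
    ∃ B : UnitAddCircle → SL(2, ℝ), IsMeasurableSL B ∧ IsLinftyBounded B ∧
      ∀ᵐ θ ∂(volume : Measure UnitAddCircle),
        IsRotationMatrix ((B (θ + α))⁻¹ * A θ * B θ) := by
  let := rotationAction α
  obtain ⟨B, hB, ⟨D, hD⟩, hrot⟩ := mainTheorem11_general
    (fun (k : Multiplicative ℤ) => fiberedProduct α A k.toAdd)
    (fun j k => fiberedProduct_add α A j.toAdd k.toAdd)
    (fun k => isMeasurableSL_of_continuous (continuous_fiberedProduct α hA k.toAdd))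
    (let ⟨C, hC⟩ := hbdd.exists_abs_le; ⟨C, fun k => hC k.toAdd⟩)
  refine ⟨B, hB, isLinftyBounded_of_abs_le hB hD, .of_forall fun θ => ?_⟩
  have hsmul : Multiplicative.ofAdd (1 : ℤ) • θ = θ + α :=
    (congrArg (· + θ) (one_zsmul α)).trans (add_comm α θ)
  have hθ := isRotationMatrix_of_mem_specialOrthogonalGroup (hrot (.ofAdd 1) θ)
  rwa [hsmul, toAdd_ofAdd, fiberedProduct_one] at hθ
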